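/- Let $n\ge 0$ and let $\mathrm{Sym}^2(\mathbb R^n)$ be the space of real symmetric $n\times n$ matrices with inner product $\langle A,B\rangle=\operatorname{tr}(AB)$. Let $\mathcal P^+\subset \mathrm{Sym}^2(\mathbb R^n)$ be an *elliptic cone*, i.e. a closed convex cone with vertex at the origin such that every element of the relative interior (the interior in its linear span) of the polar cone $\mathcal P_+=\{A\in\mathrm{Sym}^2(\mathbb R^n):\langle A,B\rangle\ge 0\text{ for all }B\in\mathcal P^+\}$ is positive definite. Let $X\subset\mathbb R^n$ be an open set. - A function $w:X\to[-\infty,\infty)$ is *subaffine* on an open set $B\subset X$ if it is upper semicontinuous on $B$ and, for every compact $K\subset B$ and every affine function $a$ on $\mathbb R^n$, $w\le a$ on $\partial K$ implies $w\le a$ on $K$. Let $\mathrm{SA}(X)$ be the set of upper semicontinuous functions $w:X\to[-\infty,\infty)$ such that every point of $X$ has an open neighbourhood $B\subset X$ on which $w$ is subaffine. - A function $u$ is an *upper semicontinuous $\mathcal P^+$-plurisubharmonic function* on $X$, written $u\in\mathrm{PSH}(X)$, if it is the canonical representative $u(x)=\operatorname{ess\,limsup}_{y\to x}f(y)$, $x\in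 X$, of a $\mathcal P^+$-plurisubharmonic distribution $T\in\mathcal D'(X)$ given by a function $f\in L^1_{\rm loc}(X)$; here $T$ is called $\mathcal P^+$-plurisubharmonic if $\sum_{i,j}A_{ij}\,(\partial_i\partial_jT)(\varphi)\ge 0$ for all $A\in\mathcal P_+$ and all test functions $\varphi\in C^\infty_{\rm cpt}(X)$ with $\varphi\ge 0$. - An upper semicontinuous function $v:X\to[-\infty,\infty)$ is *of dual type $\widetilde{\mathcal P}^+$* on $X$, written $v\in\widetilde{\mathrm{PSH}}(X)$, if for every $A\in\mathcal P^+$ the function $x\mapsto\langle Ax,x\rangle+v(x)$ belongs to $\mathrm{SA}(X)$. **Theorem 7.8 (The Subaffine Theorem).** If $u\in\mathrm{PSH}(X)$ and $v\in\widetilde{\mathrm{PSH}}(X)$, then $u+v\in\mathrm{SA}(X)$. -/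

import Mathlib

open scoped Distributions LineDeriv Topology

namespace Subaffine

/-- Euclidean space `ℝⁿ`. -/
abbrev E (n : ℕ) : Type := EuclideanSpace ℝ (Fin n)

/-! ### Cones of symmetric matrices -/

/-- The polar cone `P₊` of a cone `P⁺` in the space of symmetric matrices, for the inner product
`⟨A, B⟩ = tr (A B)`. -/
def polar {n : ℕ} (P : ProperCone ℝ (Matrix (Fin n) (Fin n) ℝ)) :
    Set (Matrix (Fin n) (Fin n) ℝ) :=
  {A | A.IsSymm ∧ ∀ B ∈ P, 0 ≤ (A * B).trace}

/-- A closed convex cone `P⁺` (with vertex at the origin) of symmetric matrices is elliptic if every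
element of the relative interior of its polar `P₊` is positive definite. The relative interior is
taken in the span of `P₊`, which is its affine span since `0 ∈ P₊`. -/
structure IsEllipticCone {n : ℕ} (P : ProperCone ℝ (Matrix (Fin n) (Fin n) ℝ)) : Prop where
  isSymm : ∀ A ∈ P, A.IsSymm
  posDef : ∀ A ∈ intrinsicInterior ℝ (polar P), A.PosDef

/-! ### Plurisubharmonic distributions and functions -/

/-- A distribution `T` on `X` is `P⁺`-plurisubharmonic if
`(Hess T)(φ A) = ∑ᵢⱼ Aᵢⱼ (∂ᵢ ∂ⱼ T)(φ) ≥ 0` for all `A ∈ P₊` and all test functions `φ ≥ 0`. -/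
def IsPSHDistribution {n : ℕ} (P : ProperCone ℝ (Matrix (Fin n) (Fin n) ℝ))
    {X : TopologicalSpace.Opens (E n)} (T : 𝓓'(X, ℝ)) : Prop :=
  ∀ A ∈ polar P, ∀ φ : 𝓓(X, ℝ), (∀ x, 0 ≤ φ x) →
    0 ≤ ∑ i : Fin n, ∑ j : Fin n,
      A i j * (∂_{EuclideanSpace.single i (1 : ℝ)} (∂_{EuclideanSpace.single j (1 : ℝ)} T)) φ

/-- The distribution `T` on `X` is given by the function `f ∈ L¹_loc(X)`
(values of `f` outside `X` play no role). -/
def IsRepresentedBy {n : ℕ} {X : TopologicalSpace.Opens (E n)} (T : 𝓓'(X, ℝ)) (f : E n → ℝ) :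
    Prop :=
  MeasureTheory.LocallyIntegrableOn f (X : Set (E n)) MeasureTheory.volume ∧
    ∀ φ : 𝓓(X, ℝ), T φ = ∫ x, f x * φ x

/-- The essential limit superior `ess limsup_{y → x} f(y)`, i.e. the limit as `r → 0` of the
essential suprema of `f` over the balls `B_r(x)`. -/
noncomputable def essLimsup {n : ℕ} (f : E n → ℝ) (x : E n) : EReal :=
  Filter.limsup (fun y => (f y : EReal)) (𝓝 x ⊓ MeasureTheory.ae MeasureTheory.volume)

/-- `u` is an upper semicontinuous `P⁺`-plurisubharmonic function on `X`: it is the canonical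
representative `x ↦ ess limsup_{y → x} f(y)` of a `P⁺`-plurisubharmonic distribution on `X`,
`f` being an `L¹_loc` function that gives this distribution. -/
def IsPSH {n : ℕ} (P : ProperCone ℝ (Matrix (Fin n) (Fin n) ℝ))
    (X : TopologicalSpace.Opens (E n)) (u : E n → EReal) : Prop :=
  ∃ (T : 𝓓'(X, ℝ)) (f : E n → ℝ), IsPSHDistribution P T ∧ IsRepresentedBy T f ∧
    ∀ x ∈ X, u x = essLimsup f x

/-! ### Subaffine functions and functions of dual type -/

/-- `w` is upper semicontinuous on `X` with values in `[-∞, ∞)`. -/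
def IsUSC {n : ℕ} (X : Set (E n)) (w : E n → EReal) : Prop :=
  UpperSemicontinuousOn w X ∧ ∀ x ∈ X, w x ≠ ⊤

/-- The comparison with affine functions: `w ≤ a` on `∂K` implies `w ≤ a` on `K`, for all compact
`K ⊆ X` and all affine functions `a`. -/
def IsSubaffine {n : ℕ} (X : Set (E n)) (w : E n → EReal) : Prop :=
  IsUSC X w ∧ ∀ K ⊆ X, IsCompact K → ∀ a : E n →ᵃ[ℝ] ℝ,
    (∀ x ∈ frontier K, w x ≤ (a x : EReal)) → ∀ x ∈ K, w x ≤ (a x : EReal)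

/-- The class `SA(X)`: upper semicontinuous functions on `X` that are subaffine near each point. -/
def IsSA {n : ℕ} (X : TopologicalSpace.Opens (E n)) (w : E n → EReal) : Prop :=
  IsUSC (X : Set (E n)) w ∧
    ∀ x ∈ X, ∃ B : Set (E n), IsOpen B ∧ x ∈ B ∧ B ⊆ (X : Set (E n)) ∧ IsSubaffine B w

/-- The quadratic function `x ↦ ⟨A x, x⟩` of a symmetric matrix. -/
def quadratic {n : ℕ} (A : Matrix (Fin n) (Fin n) ℝ) (x : E n) : ℝ :=
  ∑ i : Fin n, ∑ j : Fin n, A i j * x i * x j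

/-- `v` is of (Dirichlet) dual type `P̃⁺` on `X`: it is upper semicontinuous, and `A + v ∈ SA(X)`
for every quadratic function `A ∈ P⁺`. -/
def IsDualType {n : ℕ} (P : ProperCone ℝ (Matrix (Fin n) (Fin n) ℝ))
    (X : TopologicalSpace.Opens (E n)) (v : E n → EReal) : Prop :=
  IsUSC (X : Set (E n)) v ∧ ∀ A ∈ P, IsSA X (fun x => (quadratic A x : EReal) + v x)

end Subaffine

/-!
The theorem reduces to smooth `u` by a mollification adapted to the cone.

*Smooth case.* Let `g` be `C²` with `½ D²g ∈ P⁺` and suppose `g + v` violates the comparison with an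
affine function `a` on a compact set `K`. After adding a small multiple of `|x - x₁|²`, the function
`g + v - a` has an interior maximum point `x₀`. Replacing `g` by its second order Taylor polynomial
at `x₀` shows that `A + v`, with `A = ½ D²g(x₀) ∈ P⁺`, lies below an affine function minus
`c |x - x₀|²`, with equality at `x₀`; this contradicts `A + v ∈ SA(X)`. This is
`comparison_of_paraboloid_below`, together with `exists_affine_paraboloid_le` for the expansion, and
the bipolar theorem `mem_of_forall_polar` for the membership of the Hessian in `P⁺`.

*Approximation.* Ellipticity gives a positive definite `A ∈ P₊`, so that `u` is subharmonic for the
constant coefficient operator `L = ∑ Aᵢⱼ ∂ᵢ∂ⱼ`. Mollify `f` with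
`kₜ(z) = -2 t⁻ⁿ χ'(⟨A⁻¹z, z⟩ / t²)`. Since
`∂ₜ kₜ = t¹⁻ⁿ L [χ(⟨A⁻¹z, z⟩ / t²)]` (`hasDerivAt_kernel`) and `χ ≥ 0`, the mollifications `f ⋆ kₜ`
increase with `t`; by the Lebesgue differentiation theorem they are therefore `≥ f` almost
everywhere, hence `≥ u` everywhere. They are smooth with Hessians in `P⁺`, and their upper relaxed
limit as `t → 0` is at most `u`, directly from the definition of the essential limit superior. All
this is `exists_smooth_approximation`.

*Conclusion.* If `u + v ≤ a` on `∂K`, then `f ⋆ kₜ + v ≤ a + ε` on `∂K` for small `t`, by compactness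
and semicontinuity. The smooth case extends this to `K`, where `u ≤ f ⋆ kₜ`; let `ε → 0`.
-/

namespace Subaffine

open MeasureTheory Filter Set
open scoped Convolution ContDiff

/-! ### Comparison for functions with quadratic lower expansions -/

theorem upperSemicontinuousOn_add {α : Type*} [TopologicalSpace α] {s : Set α} {u v : α → EReal}
    (hu : UpperSemicontinuousOn u s) (hv : UpperSemicontinuousOn v s)
    (hu' : ∀ x ∈ s, u x ≠ ⊤) (hv' : ∀ x ∈ s, v x ≠ ⊤) :
    UpperSemicontinuousOn (fun x => u x + v x) s :=
  hu.add' hv fun x hx => EReal.continuousAt_add (Or.inl (hu' x hx)) (Or.inr (hv' x hx))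

/-- Comparison with affine functions for `g + v`, where `v` is of dual type and `g` has at each point
`x₀` a second order expansion from below `g ≥ l + A - o(|x - x₀|²)` with `l` affine and `A ∈ P⁺`. -/
theorem comparison_of_paraboloid_below {n : ℕ} {P : ProperCone ℝ (Matrix (Fin n) (Fin n) ℝ)}
    {X : TopologicalSpace.Opens (E n)} {v : E n → EReal} (hv : IsDualType P X v)
    {K : Set (E n)} (hKX : K ⊆ X) (hK : IsCompact K) {g : E n → ℝ} (hg : Continuous g)
    (hg2 : ∀ x₀ ∈ K, ∃ A ∈ P, ∃ l : E n →ᵃ[ℝ] ℝ, l x₀ + quadratic A x₀ = g x₀ ∧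
      ∀ c > 0, ∀ᶠ x in 𝓝 x₀, l x + quadratic A x - c * ‖x - x₀‖ ^ 2 ≤ g x)
    (a : E n →ᵃ[ℝ] ℝ) (ha : ∀ x ∈ frontier K, (g x : EReal) + v x ≤ (a x : EReal)) :
    ∀ x ∈ K, (g x : EReal) + v x ≤ (a x : EReal) := by
  intro x₁ hx₁
  by_contra! hlt
  have hacont : Continuous a := a.continuous_of_finiteDimensional
  -- values of `v` on `K` are `⊥` or real
  have hvtop : ∀ x ∈ K, v x ≠ ⊤ := fun x hx => hv.1.2 x (hKX hx)
  have hv1bot : v x₁ ≠ ⊥ := by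
    intro h; rw [h] at hlt; simp at hlt
  obtain ⟨m₁, hm₁⟩ : ∃ m : ℝ, (m : EReal) = v x₁ :=
    ⟨_, EReal.coe_toReal (hvtop _ hx₁) hv1bot⟩
  rw [← hm₁, ← EReal.coe_add, EReal.coe_lt_coe_iff] at hlt
  obtain ⟨D, hD⟩ := (hK.image (f := fun x => ‖x - x₁‖ ^ 2) (by fun_prop)).bddAbove
  have hD' : ∀ x ∈ K, ‖x - x₁‖ ^ 2 ≤ D := fun x hx => hD ⟨x, hx, rfl⟩
  have hD0 : 0 ≤ D := le_trans (by positivity) (hD' x₁ hx₁)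
  obtain ⟨δ, hδ, hδD⟩ : ∃ δ > 0, δ * D < g x₁ + m₁ - a x₁ := by
    refine ⟨(g x₁ + m₁ - a x₁) / (D + 1), div_pos (by linarith) (by linarith), ?_⟩
    rw [div_mul_eq_mul_div, div_lt_iff₀ (by linarith)]
    nlinarith
  -- a maximum point of `v + g - a + δ |x - x₁|²` is interior to `K`
  set s : E n → ℝ := fun x => g x - a x + δ * ‖x - x₁‖ ^ 2 with hs
  have hscont : Continuous s := by fun_prop
  have husc : UpperSemicontinuousOn (fun x => (s x : EReal) + v x) K :=
    upperSemicontinuousOn_add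
      ((continuous_coe_real_ereal.comp hscont).continuousOn.upperSemicontinuousOn)
      (hv.1.1.mono hKX) (fun x _ => EReal.coe_ne_top _) hvtop
  obtain ⟨x₀, hx₀, hmax⟩ := husc.exists_isMaxOn ⟨x₁, hx₁⟩ hK
  have hmax1 := hmax hx₁
  simp only [mem_ofPred_eq] at hmax1
  have hv0bot : v x₀ ≠ ⊥ := by
    intro h
    rw [h, ← hm₁, ← EReal.coe_add] at hmax1
    simp [-EReal.coe_add] at hmax1
  obtain ⟨m₀, hm₀⟩ : ∃ m : ℝ, (m : EReal) = v x₀ :=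
    ⟨_, EReal.coe_toReal (hvtop _ hx₀) hv0bot⟩
  rw [← hm₀, ← hm₁, ← EReal.coe_add, ← EReal.coe_add, EReal.coe_le_coe_iff] at hmax1
  have hmax1' : g x₁ + m₁ - a x₁ ≤ s x₀ + m₀ := by
    have : s x₁ = g x₁ - a x₁ := by simp [hs]
    linarith
  have hint : x₀ ∈ interior K := by
    by_contra hni
    have := ha x₀ ⟨subset_closure hx₀, hni⟩
    rw [← hm₀, ← EReal.coe_add, EReal.coe_le_coe_iff] at this
    have h2 := mul_le_mul_of_nonneg_left (hD' x₀ hx₀) hδ.le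
    simp only [hs] at hmax1'
    linarith
  obtain ⟨A, hA, l, hl0, hl⟩ := hg2 x₀ hx₀
  obtain ⟨-, hSA⟩ := hv.2 A hA
  obtain ⟨B, hBo, hx₀B, hBX, -, hB⟩ := hSA x₀ (hKX hx₀)
  have hev : ∀ᶠ x in 𝓝 x₀, (l x + quadratic A x - δ / 2 * ‖x - x₀‖ ^ 2 ≤ g x ∧ x ∈ K) ∧ x ∈ B :=
    ((hl (δ / 2) (by positivity)).and (mem_interior_iff_mem_nhds.1 hint)).and (hBo.mem_nhds hx₀B)
  obtain ⟨ρ, hρ, hball⟩ := Metric.nhds_basis_closedBall.mem_iff.1 hev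
  have hbd : ∀ x : E n, ‖x - x₁‖ ^ 2 = ‖x - x₀‖ ^ 2 + 2 * inner ℝ (x₀ - x₁) x
      + (‖x₁‖ ^ 2 - ‖x₀‖ ^ 2) := by
    intro x
    rw [norm_sub_sq_real, norm_sub_sq_real, inner_sub_left, real_inner_comm x₁ x,
      real_inner_comm x₀ x]
    ring
  -- the affine majorant of `A + v` on the sphere of radius `ρ`; at `x₀` it falls short by `δ ρ² / 2`
  let b : E n →ᵃ[ℝ] ℝ := a - l - (2 * δ) • (innerₗ (E n) (x₀ - x₁)).toAffineMap +
    AffineMap.const ℝ (E n) (s x₀ + m₀ - δ * (‖x₁‖ ^ 2 - ‖x₀‖ ^ 2) - δ / 2 * ρ ^ 2)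
  have hb : ∀ x, b x = a x - l x - 2 * δ * inner ℝ (x₀ - x₁) x +
      (s x₀ + m₀ - δ * (‖x₁‖ ^ 2 - ‖x₀‖ ^ 2) - δ / 2 * ρ ^ 2) := by
    intro x
    simp only [b, AffineMap.coe_add, AffineMap.coe_sub, AffineMap.coe_smul, Pi.add_apply,
      Pi.sub_apply, Pi.smul_apply, LinearMap.coe_toAffineMap, AffineMap.const_apply, smul_eq_mul,
      innerₗ_apply_apply]
  have key := hB (Metric.closedBall x₀ ρ) (fun x hx => (hball hx).2) (isCompact_closedBall _ _) b ?_
    x₀ (Metric.mem_closedBall_self hρ.le)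
  · beta_reduce at key
    rw [← hm₀, ← EReal.coe_add, EReal.coe_le_coe_iff, hb] at key
    have := hbd x₀
    simp only [sub_self, norm_zero] at this
    simp only [hs] at key
    rw [this] at key
    have : 0 < δ / 2 * ρ ^ 2 := by positivity
    nlinarith
  · intro x hx
    have hxs : ‖x - x₀‖ = ρ := by
      have := Metric.frontier_closedBall_subset_sphere hx
      rwa [mem_sphere_iff_norm] at this
    have hxK := hball (Metric.sphere_subset_closedBall (mem_sphere_iff_norm.2 hxs))
    obtain ⟨⟨h1, h2⟩, -⟩ := hxK
    by_cases hbot : v x = ⊥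
    · simp [hbot]
    obtain ⟨m, hm⟩ : ∃ m : ℝ, (m : EReal) = v x := ⟨_, EReal.coe_toReal (hvtop _ h2) hbot⟩
    have hmx := hmax h2
    simp only [mem_ofPred_eq] at hmx
    rw [← hm₀, ← hm, ← EReal.coe_add, ← EReal.coe_add, EReal.coe_le_coe_iff] at hmx
    beta_reduce
    rw [← hm, ← EReal.coe_add, EReal.coe_le_coe_iff, hb]
    have h3 := hbd x
    rw [hxs] at h3 h1
    have h4 : s x = g x - a x + δ * ‖x - x₁‖ ^ 2 := rfl
    rw [h3] at h4
    nlinarith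

/-! ### The polar cone -/

/-- The bipolar theorem: a symmetric matrix that pairs nonnegatively with `P₊` belongs to `P⁺`. -/
theorem mem_of_forall_polar {n : ℕ} {P : ProperCone ℝ (Matrix (Fin n) (Fin n) ℝ)}
    (hP : IsEllipticCone P) {B : Matrix (Fin n) (Fin n) ℝ} (hB : B.IsSymm)
    (h : ∀ A ∈ polar P, 0 ≤ (A * B).trace) : B ∈ P := by
  have : LocallyConvexSpace ℝ (Matrix (Fin n) (Fin n) ℝ) :=
    inferInstanceAs (LocallyConvexSpace ℝ (Fin n → Fin n → ℝ))
  by_contra hBP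
  obtain ⟨φ, hφ, hφB⟩ := P.hyperplane_separation_point hBP
  -- the matrix of the separating functional; only its symmetric part lies in `P₊`
  let C : Matrix (Fin n) (Fin n) ℝ := Matrix.of fun i j => φ (Matrix.single j i 1)
  have hC : ∀ M, φ M = (C * M).trace := by
    intro M
    conv_lhs => rw [Matrix.matrix_eq_sum_single M]
    simp only [map_sum, Matrix.trace, Matrix.diag, Matrix.mul_apply]
    rw [Finset.sum_comm]
    refine Finset.sum_congr rfl fun i _ => Finset.sum_congr rfl fun j _ => ?_
    have : Matrix.single j i (M j i) = M j i • Matrix.single j i (1 : ℝ) := by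
      simp
    rw [this, map_smul, smul_eq_mul, mul_comm]
    rfl
  have hsym : ∀ M : Matrix (Fin n) (Fin n) ℝ, M.IsSymm →
      ((C + C.transpose) * M).trace = 2 * φ M := by
    intro M hM
    rw [add_mul, Matrix.trace_add, ← hC, ← Matrix.trace_transpose (C.transpose * M),
      Matrix.transpose_mul, hM.eq, Matrix.transpose_transpose, Matrix.trace_mul_comm, ← hC]
    ring
  have h1 : C + C.transpose ∈ polar P := by
    refine ⟨?_, fun M hM => ?_⟩
    · rw [Matrix.IsSymm, Matrix.transpose_add, Matrix.transpose_transpose, add_comm]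
    · rw [hsym M (hP.isSymm M hM)]
      have := hφ M hM
      linarith
  have := h _ h1
  rw [hsym B hB] at this
  linarith

/-- The relative interior of the convex set `P₊` is nonempty, so ellipticity gives a positive definite
element of `P₊`. -/
theorem exists_posDef_mem_polar {n : ℕ} {P : ProperCone ℝ (Matrix (Fin n) (Fin n) ℝ)}
    (hP : IsEllipticCone P) : ∃ A ∈ polar P, A.PosDef := by
  let := Matrix.normedAddCommGroup (m := Fin n) (n := Fin n) (α := ℝ)
  let := Matrix.normedSpace (m := Fin n) (n := Fin n) (α := ℝ) (R := ℝ)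
  have hconv : Convex ℝ (polar P) := by
    intro A hA B hB a b ha hb _
    refine ⟨(hA.1.smul a).add (hB.1.smul b), fun M hM => ?_⟩
    rw [add_mul, Matrix.trace_add, Matrix.smul_mul, Matrix.smul_mul, Matrix.trace_smul,
      Matrix.trace_smul]
    exact add_nonneg (mul_nonneg ha (hA.2 M hM)) (mul_nonneg hb (hB.2 M hM))
  have hne : (polar P).Nonempty := ⟨0, by simp [polar, Matrix.IsSymm]⟩
  obtain ⟨A, hA⟩ := hne.intrinsicInterior hconv
  exact ⟨A, intrinsicInterior_subset hA, hP.posDef A hA⟩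

/-! ### Second order Taylor expansion -/

/-- The Hessian matrix of `g` at `x`, read off from the second Fréchet derivative. -/
noncomputable def hessian {n : ℕ} (g : E n → ℝ) (x : E n) : Matrix (Fin n) (Fin n) ℝ :=
  Matrix.of fun i j =>
    fderiv ℝ (fderiv ℝ g) x (EuclideanSpace.single i 1) (EuclideanSpace.single j 1)

theorem hessian_isSymm {n : ℕ} {g : E n → ℝ} (hg : ContDiff ℝ 2 g) (x : E n) :
    (hessian g x).IsSymm := by
  ext i j
  exact (hg.contDiffAt.isSymmSndFDerivAt (by simp)).eq _ _

theorem quadratic_hessian {n : ℕ} (g : E n → ℝ) (x₀ x : E n) :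
    quadratic (hessian g x₀) x = fderiv ℝ (fderiv ℝ g) x₀ x x := by
  have hx : x = ∑ i, x i • EuclideanSpace.single i (1 : ℝ) := by
    simpa using ((EuclideanSpace.basisFun (Fin n) ℝ).sum_repr x).symm
  conv_rhs => rw [hx]
  simp only [map_sum, _root_.sum_apply, map_smul, _root_.smul_apply,
    smul_eq_mul, Finset.mul_sum, quadratic, hessian, Matrix.of_apply]
  rw [Finset.sum_comm]
  exact Finset.sum_congr rfl fun i _ => Finset.sum_congr rfl fun j _ => by ring

theorem quadratic_smul {n : ℕ} (c : ℝ) (A : Matrix (Fin n) (Fin n) ℝ) (x : E n) :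
    quadratic (c • A) x = c * quadratic A x := by
  simp [quadratic, Finset.mul_sum, mul_assoc]

/-- The second order Taylor formula, as a lower bound; the affine function `l` absorbs the difference
between `½ D²g(x₀)(x - x₀, x - x₀)` and `½ D²g(x₀)(x, x)`. -/
theorem exists_affine_paraboloid_le {n : ℕ} {g : E n → ℝ} (hg : ContDiff ℝ 2 g) (x₀ : E n) :
    ∃ l : E n →ᵃ[ℝ] ℝ, l x₀ + quadratic ((1 / 2 : ℝ) • hessian g x₀) x₀ = g x₀ ∧
      ∀ c > 0, ∀ᶠ x in 𝓝 x₀,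
        l x + quadratic ((1 / 2 : ℝ) • hessian g x₀) x - c * ‖x - x₀‖ ^ 2 ≤ g x := by
  set D := fderiv ℝ g x₀ with hD
  set D2 := fderiv ℝ (fderiv ℝ g) x₀ with hD2
  have hsymm : ∀ v w, D2 v w = D2 w v := fun v w =>
    (hg.contDiffAt.isSymmSndFDerivAt (by simp)).eq v w
  let l : E n →ᵃ[ℝ] ℝ := ((D - D2 x₀ : E n →L[ℝ] ℝ) : E n →ₗ[ℝ] ℝ).toAffineMap +
    AffineMap.const ℝ (E n) (g x₀ - D x₀ + 1 / 2 * D2 x₀ x₀)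
  have hl : ∀ x, l x = D x - D2 x₀ x + (g x₀ - D x₀ + 1 / 2 * D2 x₀ x₀) := fun x => by simp [l]
  simp only [quadratic_smul, quadratic_hessian]
  refine ⟨l, by rw [hl]; ring, fun c hc => ?_⟩
  -- the Taylor remainder, whose derivative is `o(|x - x₀|)`
  set r : E n → ℝ := fun x => g x - D x - 1 / 2 * D2 (x - x₀) (x - x₀) with hr
  have hg1 : Differentiable ℝ g := hg.differentiable (by norm_num)
  have hg2 : HasFDerivAt (fderiv ℝ g) D2 x₀ :=
    ((hg.fderiv_right (m := 1) (by norm_num)).differentiable (by norm_num) x₀).hasFDerivAt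
  have hrd : ∀ x, HasFDerivAt r (fderiv ℝ g x - fderiv ℝ g x₀ - D2 (x - x₀)) x := by
    intro x
    have h1 : HasFDerivAt (fun x => x - x₀) (ContinuousLinearMap.id ℝ (E n)) x :=
      (hasFDerivAt_id x).sub_const x₀
    have h2 := (D2.hasFDerivAt.comp x h1).clm_apply h1
    have h3 := ((hg1 x).hasFDerivAt.sub D.hasFDerivAt).sub (h2.const_mul (1 / 2 : ℝ))
    refine HasFDerivAt.congr_fderiv (f := r) h3 ?_
    refine ContinuousLinearMap.ext fun v => ?_
    have h4 := hsymm v (x - x₀)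
    change fderiv ℝ g x v - D v - 1 / 2 * (D2 (x - x₀) v + D2 v (x - x₀)) =
      fderiv ℝ g x v - D v - D2 (x - x₀) v
    rw [h4]
    ring
  have hev := hg2.isLittleO.def hc
  obtain ⟨ρ, hρ, hball⟩ := Metric.nhds_basis_ball.mem_iff.1 hev
  filter_upwards [Metric.ball_mem_nhds x₀ hρ] with x hx
  have hmv := (convex_closedBall x₀ ‖x - x₀‖).norm_image_sub_le_of_norm_hasFDerivWithin_le
    (f := r) (C := c * ‖x - x₀‖) (fun y _ => (hrd y).hasFDerivWithinAt) (fun y hy => by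
      have hy' : ‖y - x₀‖ ≤ ‖x - x₀‖ := by simpa [dist_eq_norm] using hy
      have hx' : ‖x - x₀‖ < ρ := by simpa [dist_eq_norm] using hx
      have : y ∈ Metric.ball x₀ ρ := by
        rw [Metric.mem_ball, dist_eq_norm]; exact hy'.trans_lt hx'
      exact (hball this).trans (mul_le_mul_of_nonneg_left hy' hc.le))
    (Metric.mem_closedBall_self (norm_nonneg _))
    (y := x) (by simp [dist_eq_norm])
  rw [Real.norm_eq_abs] at hmv
  have h4 := (abs_le.1 hmv).1
  rw [hl]
  simp only [hr, sub_self, map_sub, _root_.sub_apply] at h4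
  have := hsymm x x₀
  nlinarith

/-! ### Constant coefficient second order operators -/

/-- The operator `∑ Aᵢⱼ ∂ⱼ∂ᵢ` with constant coefficients `A`. Line derivatives are used because the
derivatives of test functions are expressed through them. -/
noncomputable def ellipticOp {n : ℕ} (A : Matrix (Fin n) (Fin n) ℝ) (ψ : E n → ℝ) (z : E n) : ℝ :=
  ∑ i, ∑ j, A i j * lineDeriv ℝ (fun w => lineDeriv ℝ ψ w (EuclideanSpace.single i 1)) z
    (EuclideanSpace.single j 1)

theorem ellipticOp_eq_trace {n : ℕ} (A : Matrix (Fin n) (Fin n) ℝ) {g : E n → ℝ}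
    (hg : ContDiff ℝ 2 g) (x : E n) : ellipticOp A g x = (A * hessian g x).trace := by
  have hg1 : Differentiable ℝ g := hg.differentiable (by norm_num)
  have hg2 : Differentiable ℝ (fderiv ℝ g) :=
    (hg.fderiv_right (m := 1) (by norm_num)).differentiable (by norm_num)
  simp only [ellipticOp, Matrix.trace, Matrix.diag, Matrix.mul_apply]
  refine Finset.sum_congr rfl fun i _ => Finset.sum_congr rfl fun j _ => ?_
  congr 1
  have : (fun w => lineDeriv ℝ g w (EuclideanSpace.single i 1)) =
      fun w => fderiv ℝ g w (EuclideanSpace.single i 1) :=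
    funext fun w => (hg1 w).lineDeriv_eq_fderiv
  rw [this]
  have h := (hg2 x).hasFDerivAt.clm_apply (hasFDerivAt_const (EuclideanSpace.single i (1 : ℝ)) x)
  rw [h.differentiableAt.lineDeriv_eq_fderiv, h.fderiv]
  simp [hessian]

theorem lineDeriv_comp_const_sub {F : Type*} [AddCommGroup F] [Module ℝ F] (ψ : F → ℝ)
    (x y v : F) : lineDeriv ℝ (fun y => ψ (x - y)) y v = -lineDeriv ℝ ψ (x - y) v := by
  rw [lineDeriv, lineDeriv]
  have : (fun t : ℝ => ψ (x - (y + t • v))) = fun t => (fun s : ℝ => ψ (x - y + s • v)) (-t) := by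
    funext t; congr 1; simp only [neg_smul]; abel
  rw [this, deriv_comp_neg (fun s : ℝ => ψ (x - y + s • v)), neg_zero]

theorem ellipticOp_comp_const_sub {n : ℕ} (A : Matrix (Fin n) (Fin n) ℝ) (ψ : E n → ℝ)
    (x y : E n) : ellipticOp A (fun y => ψ (x - y)) y = ellipticOp A ψ (x - y) := by
  simp only [ellipticOp, lineDeriv_comp_const_sub ψ x]
  refine Finset.sum_congr rfl fun i _ => Finset.sum_congr rfl fun j _ => ?_
  congr 1
  rw [show ∀ (g : E n → ℝ) v, lineDeriv ℝ (fun w => -g w) y v = -lineDeriv ℝ g y v from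
      fun g v => deriv.fun_neg, lineDeriv_comp_const_sub (fun w => lineDeriv ℝ ψ w (EuclideanSpace.single i 1)), neg_neg]

theorem lineDeriv_eq_zero_of_notMem_tsupport {F : Type*} [NormedAddCommGroup F] [NormedSpace ℝ F]
    {ψ : F → ℝ} {x : F} (hx : x ∉ tsupport ψ) (v : F) : lineDeriv ℝ ψ x v = 0 := by
  have h0 : ψ =ᶠ[𝓝 x] fun _ => 0 := notMem_tsupport_iff_eventuallyEq.1 hx
  rw [h0.lineDeriv_eq]
  simp [lineDeriv]

theorem ellipticOp_eq_zero_of_notMem_tsupport {n : ℕ} (A : Matrix (Fin n) (Fin n) ℝ)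
    {ψ : E n → ℝ} {x : E n} (hx : x ∉ tsupport ψ) : ellipticOp A ψ x = 0 := by
  have h0 : ∀ᶠ y in 𝓝 x, y ∉ tsupport ψ := (isClosed_tsupport ψ).isOpen_compl.mem_nhds hx
  refine Finset.sum_eq_zero fun i _ => Finset.sum_eq_zero fun j _ => ?_
  have : (fun w => lineDeriv ℝ ψ w (EuclideanSpace.single i 1)) =ᶠ[𝓝 x] fun _ => 0 := by
    filter_upwards [h0] with y hy using lineDeriv_eq_zero_of_notMem_tsupport hy _
  rw [this.lineDeriv_eq]
  simp [lineDeriv]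

/-- Plurisubharmonicity of the distribution `f`, tested against the translated reflection
`y ↦ ψ (x - y)` of `ψ`. -/
theorem integral_mul_ellipticOp_nonneg {n : ℕ} {P : ProperCone ℝ (Matrix (Fin n) (Fin n) ℝ)}
    {X : TopologicalSpace.Opens (E n)} {T : 𝓓'(X, ℝ)} {f : E n → ℝ}
    (hT : IsPSHDistribution P T) (hTf : IsRepresentedBy T f)
    {A : Matrix (Fin n) (Fin n) ℝ} (hA : A ∈ polar P)
    {ψ : E n → ℝ} (hψ : ContDiff ℝ ∞ ψ) (hψc : HasCompactSupport ψ) (hψ0 : ∀ z, 0 ≤ ψ z)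
    {x : E n} (hx : ∀ y, x - y ∈ tsupport ψ → y ∈ X) :
    0 ≤ ∫ y, f y * ellipticOp A ψ (x - y) := by
  have hsub : (fun y => ψ (x - y)) = ψ ∘ Homeomorph.subLeft x := rfl
  let φ : 𝓓(X, ℝ) :=
    { toFun := fun y => ψ (x - y)
      contDiff' := hψ.comp (contDiff_const.sub contDiff_id)
      hasCompactSupport' := by
        rw [hsub]; exact hψc.comp_homeomorph _
      tsupport_subset' := by
        rw [hsub, tsupport_comp_eq_preimage]
        exact fun y hy => hx y hy }
  let Φ : 𝓓(X, ℝ) := ∑ i : Fin n, ∑ j : Fin n, A i j •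
    ∂_{EuclideanSpace.single j (1 : ℝ)} (∂_{EuclideanSpace.single i (1 : ℝ)} φ)
  have hΦ : ∀ y, Φ y = ellipticOp A ψ (x - y) := by
    intro y
    rw [← ellipticOp_comp_const_sub]
    have hl : ∀ (η : 𝓓(X, ℝ)) (v y : E n), (∂_{v} η) y = lineDeriv ℝ η y v := fun η v y =>
      TestFunction.lineDerivCLM_apply_of_le le_top
    simp only [Φ, ellipticOp, sum_apply]
    refine Finset.sum_congr rfl fun i _ => Finset.sum_congr rfl fun j _ => ?_
    rw [_root_.smul_apply, smul_eq_mul, hl, show ⇑(∂_{EuclideanSpace.single i (1 : ℝ)} φ : 𝓓(X, ℝ)) =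
      fun w => lineDeriv ℝ φ w (EuclideanSpace.single i 1) from funext fun w => hl φ _ w]
    rfl
  have h := hT A hA φ fun y => hψ0 _
  have h2 : T Φ = ∑ i : Fin n, ∑ j : Fin n,
      A i j * (∂_{EuclideanSpace.single i (1 : ℝ)} (∂_{EuclideanSpace.single j (1 : ℝ)} T)) φ := by
    simp only [Φ, map_sum, map_smul, Distribution.lineDerivOp_apply_apply, map_neg, neg_neg,
      smul_eq_mul]
  rw [← h2, hTf.2] at h
  simpa only [hΦ] using h

theorem ellipticOp_convolution {n : ℕ} (A : Matrix (Fin n) (Fin n) ℝ) {f ψ : E n → ℝ}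
    (hf : LocallyIntegrable f) (hψ : ContDiff ℝ ∞ ψ) (hψc : HasCompactSupport ψ) (x : E n) :
    ellipticOp A (f ⋆[ContinuousLinearMap.mul ℝ ℝ] ψ) x = ∫ y, f y * ellipticOp A ψ (x - y) := by
  have key : ∀ (ψ : E n → ℝ) (_ : ContDiff ℝ ∞ ψ) (_ : HasCompactSupport ψ) (v x : E n),
      lineDeriv ℝ (f ⋆[ContinuousLinearMap.mul ℝ ℝ] ψ) x v =
        (f ⋆[ContinuousLinearMap.mul ℝ ℝ] fun z => lineDeriv ℝ ψ z v) x := by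
    intro ψ hψ hψc v x
    have h := hψc.hasFDerivAt_convolution_right (ContinuousLinearMap.mul ℝ ℝ) hf
      (hψ.of_le (by simp)) x
    rw [h.differentiableAt.lineDeriv_eq_fderiv, h.fderiv,
      convolution_precompR_apply _ hf (hψc.fderiv ℝ) (hψ.continuous_fderiv (by simp))]
    congr 1
    funext z
    exact ((hψ.differentiable (by simp)) z).lineDeriv_eq_fderiv.symm
  have hsm : ∀ (ψ : E n → ℝ) (_ : ContDiff ℝ ∞ ψ) (v : E n),
      ContDiff ℝ ∞ fun z => lineDeriv ℝ ψ z v := by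
    intro ψ hψ v
    have : (fun z => lineDeriv ℝ ψ z v) = fun z => fderiv ℝ ψ z v :=
      funext fun z => ((hψ.differentiable (by simp)) z).lineDeriv_eq_fderiv
    rw [this]
    exact (hψ.fderiv_right (by simp)).clm_apply contDiff_const
  have hcs : ∀ (ψ : E n → ℝ) (_ : HasCompactSupport ψ) (v : E n),
      HasCompactSupport fun z => lineDeriv ℝ ψ z v := fun ψ hψc v =>
    hψc.mono' fun z hz => by
      by_contra h
      exact hz (lineDeriv_eq_zero_of_notMem_tsupport h v)
  simp only [ellipticOp, key ψ hψ hψc]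
  have hint : ∀ i j : Fin n, Integrable fun y => f y * (A i j * lineDeriv ℝ
      (fun w => lineDeriv ℝ ψ w (EuclideanSpace.single i 1)) (x - y)
        (EuclideanSpace.single j 1)) := by
    intro i j
    have h := ((hcs _ (hcs ψ hψc (EuclideanSpace.single i 1))
      (EuclideanSpace.single j 1)).convolutionExists_right (ContinuousLinearMap.mul ℝ ℝ) hf
        (hsm _ (hsm ψ hψ _) _).continuous x).integrable.const_mul (A i j)
    refine h.congr (Eventually.of_forall fun y => ?_)
    simp only [ContinuousLinearMap.mul_apply']
    ring
  simp only [Finset.mul_sum]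
  rw [integral_finsetSum _ fun i _ => integrable_finsetSum _ fun j _ => hint i j]
  refine Finset.sum_congr rfl fun i _ => ?_
  rw [integral_finsetSum _ fun j _ => hint i j]
  refine Finset.sum_congr rfl fun j _ => ?_
  rw [key _ (hsm ψ hψ _) (hcs ψ hψc _), convolution_def, ← integral_const_mul]
  congr 1
  funext y
  simp only [ContinuousLinearMap.mul_apply']
  ring

/-! ### Positive definite quadratic forms -/

theorem contDiff_quadratic {n : ℕ} (G : Matrix (Fin n) (Fin n) ℝ) : ContDiff ℝ ∞ (quadratic G) := by
  unfold quadratic; fun_prop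

theorem quadratic_eq_dotProduct {n : ℕ} (G : Matrix (Fin n) (Fin n) ℝ) (z : E n) :
    quadratic G z = z.ofLp ⬝ᵥ G.mulVec z.ofLp := by
  simp only [quadratic, dotProduct, Matrix.mulVec, Finset.mul_sum]
  exact Finset.sum_congr rfl fun i _ => Finset.sum_congr rfl fun j _ => by ring

theorem quadratic_const_smul {n : ℕ} (G : Matrix (Fin n) (Fin n) ℝ) (c : ℝ) (z : E n) :
    quadratic G (c • z) = c ^ 2 * quadratic G z := by
  simp only [quadratic, Finset.mul_sum, PiLp.smul_apply, smul_eq_mul]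
  exact Finset.sum_congr rfl fun i _ => Finset.sum_congr rfl fun j _ => by ring

theorem quadratic_add_smul {n : ℕ} {G : Matrix (Fin n) (Fin n) ℝ} (hG : G.IsSymm) (z v : E n)
    (s : ℝ) : quadratic G (z + s • v) =
      quadratic G z + 2 * s * (v.ofLp ⬝ᵥ G.mulVec z.ofLp) + s ^ 2 * quadratic G v := by
  have h : z.ofLp ⬝ᵥ G.mulVec v.ofLp = v.ofLp ⬝ᵥ G.mulVec z.ofLp := by
    rw [Matrix.dotProduct_mulVec, ← Matrix.mulVec_transpose, hG.eq, dotProduct_comm]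
  simp only [quadratic_eq_dotProduct, WithLp.ofLp_add, WithLp.ofLp_smul, Matrix.mulVec_add,
    Matrix.mulVec_smul, dotProduct_add, add_dotProduct, smul_dotProduct, dotProduct_smul, h,
    smul_eq_mul]
  ring

theorem exists_norm_sq_le_quadratic {n : ℕ} {G : Matrix (Fin n) (Fin n) ℝ} (hG : G.PosDef) :
    ∃ R > 0, ∀ z : E n, ‖z‖ ^ 2 ≤ R ^ 2 * quadratic G z := by
  have hpos : ∀ z : E n, z ≠ 0 → 0 < quadratic G z := by
    intro z hz
    rw [quadratic_eq_dotProduct]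
    have := hG.dotProduct_mulVec_pos (x := z.ofLp) (by simpa using hz)
    simpa using this
  obtain ⟨c, hc, hcs⟩ := (isCompact_sphere (0 : E n) 1).exists_forall_le'
    (f := quadratic G) (a := 0) (contDiff_quadratic G).continuous.continuousOn (fun z hz => hpos z (by
      rintro rfl; simp at hz))
  refine ⟨√c⁻¹, by positivity, fun z => ?_⟩
  rw [Real.sq_sqrt (by positivity), inv_mul_eq_div, le_div_iff₀ hc]
  by_cases hz : z = 0
  · simp [hz, quadratic]
  have h := hcs (‖z‖⁻¹ • z) (by simp [norm_smul, hz])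
  rw [quadratic_const_smul, inv_pow, inv_mul_eq_div, le_div_iff₀ (by positivity)] at h
  linarith

/-! ### The mollification kernels -/

/-- The function `z ↦ χ(⟨G z, z⟩ / t²)`, whose image under `∑ (G⁻¹)ᵢⱼ ∂ᵢ∂ⱼ` is, up to a power of `t`,
the `t`-derivative of `kernel G χ t`. -/
noncomputable def potential {n : ℕ} (G : Matrix (Fin n) (Fin n) ℝ) (χ : ℝ → ℝ) (t : ℝ) (z : E n) :
    ℝ :=
  χ (quadratic G z / t ^ 2)

/-- The mollification kernel `z ↦ -2 t⁻ⁿ χ'(⟨G z, z⟩ / t²)` at scale `t`; it is nonnegative for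
decreasing `χ`. -/
noncomputable def kernel {n : ℕ} (G : Matrix (Fin n) (Fin n) ℝ) (χ : ℝ → ℝ) (t : ℝ) (z : E n) :
    ℝ :=
  -2 * deriv χ (quadratic G z / t ^ 2) * (t ^ n)⁻¹

theorem contDiff_potential {n : ℕ} (G : Matrix (Fin n) (Fin n) ℝ) {χ : ℝ → ℝ}
    (hχ : ContDiff ℝ ∞ χ) (t : ℝ) : ContDiff ℝ ∞ (potential G χ t) :=
  hχ.comp ((contDiff_quadratic G).div_const _)

theorem contDiff_deriv {χ : ℝ → ℝ} (hχ : ContDiff ℝ ∞ χ) : ContDiff ℝ ∞ (deriv χ) :=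
  (contDiff_infty_iff_deriv.1 hχ).2

theorem contDiff_kernel {n : ℕ} (G : Matrix (Fin n) (Fin n) ℝ) {χ : ℝ → ℝ}
    (hχ : ContDiff ℝ ∞ χ) (t : ℝ) : ContDiff ℝ ∞ (kernel G χ t) :=
  (contDiff_const.mul ((contDiff_deriv hχ).comp ((contDiff_quadratic G).div_const _))).mul
    contDiff_const

theorem contDiffOn_uncurry_kernel {n : ℕ} (G : Matrix (Fin n) (Fin n) ℝ) {χ : ℝ → ℝ}
    (hχ : ContDiff ℝ ∞ χ) {s : Set ℝ} (hs : ∀ t ∈ s, t ≠ 0) :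
    ContDiffOn ℝ ∞ (fun p : ℝ × E n => kernel G χ p.1 p.2) (s ×ˢ univ) := by
  have h1 : ContDiffOn ℝ ∞ (fun p : ℝ × E n => quadratic G p.2 / p.1 ^ 2) (s ×ˢ univ) :=
    ((contDiff_quadratic G).comp contDiff_snd).contDiffOn.div (contDiff_fst.pow 2).contDiffOn
      fun p hp => pow_ne_zero _ (hs _ hp.1)
  refine (contDiffOn_const.mul ((contDiff_deriv hχ).comp_contDiffOn h1)).mul ?_
  exact (contDiff_fst.pow n).contDiffOn.inv fun p hp => pow_ne_zero _ (hs _ hp.1)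

theorem kernel_nonneg {n : ℕ} (G : Matrix (Fin n) (Fin n) ℝ) {χ : ℝ → ℝ}
    (hχ : ∀ s, deriv χ s ≤ 0) {t : ℝ} (ht : 0 < t) (z : E n) : 0 ≤ kernel G χ t z := by
  have := hχ (quadratic G z / t ^ 2)
  exact mul_nonneg (by linarith) (by positivity)

theorem deriv_eq_zero_of_one_lt {χ : ℝ → ℝ} (hχ : ∀ s, 1 ≤ s → χ s = 0) {s : ℝ} (hs : 1 < s) :
    deriv χ s = 0 := by
  have : χ =ᶠ[𝓝 s] fun _ => 0 := by
    filter_upwards [lt_mem_nhds hs] with r hr using hχ r hr.le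
  rw [this.deriv_eq, deriv_const]

theorem norm_le_of_quadratic_div_le {n : ℕ} {G : Matrix (Fin n) (Fin n) ℝ} {R : ℝ} (hR : 0 < R)
    (hG : ∀ z : E n, ‖z‖ ^ 2 ≤ R ^ 2 * quadratic G z) {t : ℝ} (ht : 0 < t) {z : E n}
    (hz : quadratic G z / t ^ 2 ≤ 1) : ‖z‖ ≤ R * t := by
  rw [div_le_one (by positivity)] at hz
  refine le_of_sq_le_sq ?_ (by positivity)
  have := hG z
  have h2 := mul_le_mul_of_nonneg_left hz (sq_nonneg R)
  nlinarith

theorem tsupport_kernel_subset {n : ℕ} {G : Matrix (Fin n) (Fin n) ℝ} {R : ℝ} (hR : 0 < R)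
    (hG : ∀ z : E n, ‖z‖ ^ 2 ≤ R ^ 2 * quadratic G z) {χ : ℝ → ℝ} (hχ : ∀ s, 1 ≤ s → χ s = 0)
    {t : ℝ} (ht : 0 < t) : tsupport (kernel (n := n) G χ t) ⊆ Metric.closedBall 0 (R * t) := by
  refine closure_minimal (fun z hz => ?_) Metric.isClosed_closedBall
  rw [mem_closedBall_zero_iff]
  refine norm_le_of_quadratic_div_le hR hG ht ?_
  by_contra! h
  exact hz (by simp [kernel, deriv_eq_zero_of_one_lt hχ h])

theorem tsupport_potential_subset {n : ℕ} {G : Matrix (Fin n) (Fin n) ℝ} {R : ℝ} (hR : 0 < R)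
    (hG : ∀ z : E n, ‖z‖ ^ 2 ≤ R ^ 2 * quadratic G z) {χ : ℝ → ℝ} (hχ : ∀ s, 1 ≤ s → χ s = 0)
    {t : ℝ} (ht : 0 < t) : tsupport (potential (n := n) G χ t) ⊆ Metric.closedBall 0 (R * t) := by
  refine closure_minimal (fun z hz => ?_) Metric.isClosed_closedBall
  rw [mem_closedBall_zero_iff]
  refine norm_le_of_quadratic_div_le hR hG ht ?_
  by_contra! h
  exact hz (hχ _ h.le)

theorem kernel_eq_kernel_one {n : ℕ} (G : Matrix (Fin n) (Fin n) ℝ) (χ : ℝ → ℝ) (t : ℝ) (z : E n) :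
    kernel G χ t z = (t ^ n)⁻¹ * kernel G χ 1 (t⁻¹ • z) := by
  simp only [kernel, quadratic_const_smul]
  rw [div_eq_inv_mul (quadratic G z)]
  simp
  ring

theorem integral_kernel {n : ℕ} (G : Matrix (Fin n) (Fin n) ℝ) (χ : ℝ → ℝ) {t : ℝ} (ht : 0 < t) :
    ∫ z : E n, kernel G χ t z = ∫ z : E n, kernel G χ 1 z := by
  simp_rw [kernel_eq_kernel_one G χ t]
  rw [integral_const_mul, Measure.integral_comp_smul, finrank_euclideanSpace_fin, smul_eq_mul,
    inv_pow, inv_inv, abs_of_pos (by positivity), inv_mul_cancel_left₀ (by positivity)]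

theorem ellipticOp_potential {n : ℕ} {A G : Matrix (Fin n) (Fin n) ℝ} (hG : G.IsSymm)
    (hAG : A * G = 1) {χ : ℝ → ℝ} (hχ : ContDiff ℝ ∞ χ) (t : ℝ) (z : E n) :
    ellipticOp A (potential G χ t) z =
      4 * deriv (deriv χ) (quadratic G z / t ^ 2) * quadratic G z / t ^ 4 +
        2 * n * deriv χ (quadratic G z / t ^ 2) / t ^ 2 := by
  have hq : ∀ w v : E n, HasDerivAt (fun s : ℝ => quadratic G (w + s • v) / t ^ 2)
      (2 * (v.ofLp ⬝ᵥ G.mulVec w.ofLp) / t ^ 2) 0 := by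
    intro w v
    simp only [quadratic_add_smul hG]
    have h : HasDerivAt (fun s : ℝ => quadratic G w + 2 * s * (v.ofLp ⬝ᵥ G.mulVec w.ofLp) +
        s ^ 2 * quadratic G v) (2 * 1 * (v.ofLp ⬝ᵥ G.mulVec w.ofLp) +
          ((2 : ℕ) * (0 : ℝ) ^ (2 - 1) * 1) * quadratic G v) 0 :=
      ((((hasDerivAt_id (0 : ℝ)).const_mul 2).mul_const _).const_add _).add
        (((hasDerivAt_id (0 : ℝ)).pow 2).mul_const _)
    exact (h.div_const (t ^ 2)).congr_deriv (by simp)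
  have hcomp : ∀ (η : ℝ → ℝ), Differentiable ℝ η → ∀ w v : E n,
      HasDerivAt (fun s : ℝ => η (quadratic G (w + s • v) / t ^ 2))
        (deriv η (quadratic G w / t ^ 2) * (2 * (v.ofLp ⬝ᵥ G.mulVec w.ofLp) / t ^ 2)) 0 := by
    intro η hη w v
    exact ((hη (quadratic G (w + (0 : ℝ) • v) / t ^ 2)).hasDerivAt.comp (0 : ℝ)
      (hq w v)).congr_deriv (by simp)
  have h1 : ∀ w v : E n, lineDeriv ℝ (potential G χ t) w v =
      deriv χ (quadratic G w / t ^ 2) * (2 * (v.ofLp ⬝ᵥ G.mulVec w.ofLp) / t ^ 2) := fun w v =>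
    (hcomp χ (hχ.differentiable (by simp)) w v).deriv
  have h2 : ∀ v v' : E n, lineDeriv ℝ (fun w => lineDeriv ℝ (potential G χ t) w v) z v' =
      deriv (deriv χ) (quadratic G z / t ^ 2) * (2 * (v'.ofLp ⬝ᵥ G.mulVec z.ofLp) / t ^ 2) *
        (2 * (v.ofLp ⬝ᵥ G.mulVec z.ofLp) / t ^ 2) +
      deriv χ (quadratic G z / t ^ 2) * (2 * (v.ofLp ⬝ᵥ G.mulVec v'.ofLp) / t ^ 2) := by
    intro v v'
    simp only [h1]
    have ha := hcomp (deriv χ) ((contDiff_deriv hχ).differentiable (by simp)) z v'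
    have hb : HasDerivAt (fun s : ℝ => 2 * (v.ofLp ⬝ᵥ G.mulVec (z + s • v').ofLp) / t ^ 2)
        (2 * (v.ofLp ⬝ᵥ G.mulVec v'.ofLp) / t ^ 2) 0 := by
      simp only [WithLp.ofLp_add, WithLp.ofLp_smul, Matrix.mulVec_add, Matrix.mulVec_smul,
        dotProduct_add, dotProduct_smul, smul_eq_mul]
      exact (((((hasDerivAt_id (0 : ℝ)).mul_const (v.ofLp ⬝ᵥ G.mulVec v'.ofLp)).const_add
        (v.ofLp ⬝ᵥ G.mulVec z.ofLp)).const_mul 2).div_const (t ^ 2)).congr_deriv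
          (by simp)
    exact (ha.mul hb).deriv.trans (by simp)
  have hsum : ∑ i, ∑ j, A i j * (G.mulVec z.ofLp j * G.mulVec z.ofLp i) = quadratic G z := by
    have : quadratic G z = G.mulVec z.ofLp ⬝ᵥ A.mulVec (G.mulVec z.ofLp) := by
      rw [Matrix.mulVec_mulVec, hAG, Matrix.one_mulVec, quadratic_eq_dotProduct, dotProduct_comm]
    rw [this]
    rw [dotProduct]
    refine Finset.sum_congr rfl fun i _ => ?_
    change _ = G.mulVec z.ofLp i * ∑ j, A i j * G.mulVec z.ofLp j
    rw [Finset.mul_sum]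
    exact Finset.sum_congr rfl fun j _ => by ring
  have htr : ∑ i, ∑ j, A i j * G i j = n := by
    have : (A * G).trace = n := by rw [hAG]; simp
    rw [← this]
    simp only [Matrix.trace, Matrix.diag, Matrix.mul_apply]
    refine Finset.sum_congr rfl fun i _ => Finset.sum_congr rfl fun j _ => ?_
    rw [hG.apply]
  simp only [ellipticOp, h2]
  have hs : ∀ i w, (EuclideanSpace.single i (1 : ℝ)).ofLp ⬝ᵥ G.mulVec w = G.mulVec w i := by
    intro i w; simp
  have hs2 : ∀ i j, G.mulVec (EuclideanSpace.single j (1 : ℝ)).ofLp i = G i j := by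
    intro i w; simp
  simp only [hs, hs2]
  set a := deriv (deriv χ) (quadratic G z / t ^ 2)
  set b := deriv χ (quadratic G z / t ^ 2)
  calc _ = ∑ i, ∑ j, (4 * a / t ^ 4 * (A i j * (G.mulVec z.ofLp j * G.mulVec z.ofLp i)) +
        2 * b / t ^ 2 * (A i j * G i j)) :=
        Finset.sum_congr rfl fun i _ => Finset.sum_congr rfl fun j _ => by ring
    _ = _ := by
      simp only [Finset.sum_add_distrib, ← Finset.mul_sum, hsum, htr]
      ring

/-- The key identity `∂ₜ kₜ = t¹⁻ⁿ L [χ(⟨G z, z⟩ / t²)]` for `L = ∑ Aᵢⱼ ∂ᵢ∂ⱼ` and `G = A⁻¹`. It makes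
mollifications of `L`-subharmonic functions increase with `t`. -/
theorem hasDerivAt_kernel {n : ℕ} {A G : Matrix (Fin n) (Fin n) ℝ} (hG : G.IsSymm)
    (hAG : A * G = 1) {χ : ℝ → ℝ} (hχ : ContDiff ℝ ∞ χ) {t : ℝ} (ht : 0 < t) (z : E n) :
    HasDerivAt (fun s => kernel G χ s z)
      (t * (t ^ n)⁻¹ * ellipticOp A (potential G χ t) z) t := by
  rw [ellipticOp_potential hG hAG hχ]
  have h1 : HasDerivAt (fun s : ℝ => quadratic G z / s ^ 2)
      ((0 * t ^ 2 - quadratic G z * ((2 : ℕ) * t ^ (2 - 1) * 1)) / (t ^ 2) ^ 2) t :=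
    (hasDerivAt_const t _).div ((hasDerivAt_id t).pow 2) (by positivity)
  have h2 := (((contDiff_deriv hχ).differentiable (by simp)
    (quadratic G z / t ^ 2)).hasDerivAt.comp t h1).const_mul (-2)
  have h3 : HasDerivAt (fun s : ℝ => (s ^ n)⁻¹) (-(n * t ^ n / t) / (t ^ n) ^ 2) t := by
    refine ((hasDerivAt_pow n t).fun_inv (by positivity)).congr_deriv ?_
    congr 2
    rcases n with _ | n
    · simp
    · rw [Nat.add_sub_cancel, pow_succ]; field_simp
  refine (h2.mul h3).congr_deriv ?_
  simp only [Function.comp]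
  field_simp
  ring

/-- A profile `χ` for which `kernel G χ t` is a smooth nonnegative kernel of total mass one, supported
where `⟨G z, z⟩ ≤ t²`. -/
theorem exists_profile {n : ℕ} {G : Matrix (Fin n) (Fin n) ℝ} (hG : G.PosDef) :
    ∃ χ : ℝ → ℝ, ContDiff ℝ ∞ χ ∧ (∀ s, 1 ≤ s → χ s = 0) ∧ (∀ s, 0 ≤ χ s) ∧
      (∀ s, deriv χ s ≤ 0) ∧ ∫ z : E n, kernel G χ 1 z = 1 := by
  obtain ⟨R, hR, hRG⟩ := exists_norm_sq_le_quadratic hG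
  let χ : ℝ → ℝ := fun s => expNegInvGlue (1 - s)
  have hχ : ContDiff ℝ ∞ χ := expNegInvGlue.contDiff.comp (contDiff_const.sub contDiff_id)
  have hχ1 : ∀ s, 1 ≤ s → χ s = 0 := fun s hs =>
    expNegInvGlue.zero_of_nonpos (by linarith)
  have hχ0 : ∀ s, 0 ≤ χ s := fun s => expNegInvGlue.nonneg _
  have hanti : Antitone χ := fun s r hsr => expNegInvGlue.monotone (by linarith)
  have hχd : ∀ s, deriv χ s ≤ 0 := fun s => hanti.deriv_nonpos
  have hχd0 : deriv χ 0 ≠ 0 := by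
    have h := expNegInvGlue.hasDerivAt_polynomial_eval_inv_mul 1 1
    have h' := HasDerivAt.comp_const_sub (f := expNegInvGlue) (a := 1) (x := 0)
      (f' := expNegInvGlue 1) (by simpa using h)
    rw [show deriv χ 0 = _ from h'.deriv]
    have := expNegInvGlue.pos_of_pos one_pos
    exact neg_ne_zero.2 this.ne'
  have hc : HasCompactSupport (kernel (n := n) G χ 1) :=
    (isCompact_closedBall _ _).of_isClosed_subset (isClosed_tsupport _)
      (tsupport_kernel_subset hR hRG hχ1 one_pos)
  have hpos : 0 < ∫ z : E n, kernel G χ 1 z :=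
    (contDiff_kernel G hχ 1).continuous.integral_pos_of_hasCompactSupport_nonneg_nonzero hc
      (kernel_nonneg G hχd one_pos) (x := 0) (by
        simpa [kernel, quadratic] using hχd0)
  set c := ∫ z : E n, kernel G χ 1 z
  have hd : ∀ s, deriv (fun s => c⁻¹ * χ s) s = c⁻¹ * deriv χ s := fun s =>
    deriv_const_mul _ (hχ.differentiable (by simp) s)
  refine ⟨fun s => c⁻¹ * χ s, contDiff_const.mul hχ, fun s hs => by simp [hχ1 s hs],
    fun s => mul_nonneg (by positivity) (hχ0 s), fun s => ?_, ?_⟩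
  · rw [hd]
    exact mul_nonpos_of_nonneg_of_nonpos (by positivity) (hχd s)
  · have : ∀ z : E n, kernel G (fun s => c⁻¹ * χ s) 1 z = c⁻¹ * kernel G χ 1 z := by
      intro z; simp only [kernel, hd]; ring
    simp_rw [this]
    rw [integral_const_mul]
    exact inv_mul_cancel₀ hpos.ne'

/-! ### Mollifications -/

theorem mollification_le_of_ae_le {n : ℕ} {G : Matrix (Fin n) (Fin n) ℝ} {R : ℝ} (hR : 0 < R)
    (hG : ∀ z : E n, ‖z‖ ^ 2 ≤ R ^ 2 * quadratic G z) {χ : ℝ → ℝ} (hχ : ContDiff ℝ ∞ χ)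
    (hχ1 : ∀ s, 1 ≤ s → χ s = 0) (hχd : ∀ s, deriv χ s ≤ 0)
    (hint : ∫ z : E n, kernel G χ 1 z = 1) {f : E n → ℝ} (hf : LocallyIntegrable f)
    {t : ℝ} (ht : 0 < t) {x : E n} {c : ℝ}
    (hc : ∀ᵐ y, y ∈ Metric.closedBall x (R * t) → f y ≤ c) :
    (f ⋆[ContinuousLinearMap.mul ℝ ℝ] kernel G χ t) x ≤ c := by
  have hsupp := tsupport_kernel_subset hR hG hχ1 ht
  have hcs : HasCompactSupport (kernel (n := n) G χ t) :=
    (isCompact_closedBall _ _).of_isClosed_subset (isClosed_tsupport _) hsupp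
  have hcont := (contDiff_kernel (n := n) G hχ t).continuous
  have hi1 := (hcs.convolutionExists_right (ContinuousLinearMap.mul ℝ ℝ) hf hcont x).integrable
  have hi2 : Integrable fun y => c * kernel G χ t (x - y) :=
    ((hcont.integrable_of_hasCompactSupport hcs).comp_sub_left x).const_mul c
  have h1 : ∫ y, c * kernel G χ t (x - y) = c := by
    rw [integral_const_mul, integral_sub_left_eq_self (kernel G χ t) volume x,
      integral_kernel G χ ht, hint, mul_one]
  rw [convolution_def, ← h1]
  refine integral_mono_ae hi1 hi2 ?_
  filter_upwards [hc] with y hy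
  simp only [ContinuousLinearMap.mul_apply']
  by_cases hk : kernel G χ t (x - y) = 0
  · simp [hk]
  · refine mul_le_mul_of_nonneg_right (hy ?_) (kernel_nonneg G hχd ht _)
    have := hsupp (subset_tsupport _ hk)
    rw [mem_closedBall_zero_iff] at this
    rwa [Metric.mem_closedBall, dist_comm, dist_eq_norm]

/-- Mollifications converge to `f` at its Lebesgue points. -/
theorem ae_tendsto_mollification {n : ℕ} {G : Matrix (Fin n) (Fin n) ℝ} {R : ℝ} (hR : 0 < R)
    (hG : ∀ z : E n, ‖z‖ ^ 2 ≤ R ^ 2 * quadratic G z) {χ : ℝ → ℝ} (hχ : ContDiff ℝ ∞ χ)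
    (hχ1 : ∀ s, 1 ≤ s → χ s = 0)
    (hint : ∫ z : E n, kernel G χ 1 z = 1) {f : E n → ℝ} (hf : LocallyIntegrable f) :
    ∀ᵐ x, Tendsto (fun t => (f ⋆[ContinuousLinearMap.mul ℝ ℝ] kernel G χ t) x) (𝓝[>] 0)
      (𝓝 (f x)) := by
  have hcs : HasCompactSupport (kernel (n := n) G χ 1) :=
    (isCompact_closedBall _ _).of_isClosed_subset (isClosed_tsupport _)
      (tsupport_kernel_subset hR hG hχ1 one_pos)
  obtain ⟨M, hM⟩ := hcs.exists_bound_of_continuous (contDiff_kernel G hχ 1).continuous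
  filter_upwards [(Besicovitch.vitaliFamily volume).ae_tendsto_average_norm_sub hf] with x hx
  have hlim : Tendsto (fun t : ℝ => R * t) (𝓝[>] 0) (𝓝[>] 0) := by
    refine tendsto_nhdsWithin_iff.2 ⟨?_, ?_⟩
    · have : Tendsto (fun t : ℝ => R * t) (𝓝 0) (𝓝 (R * 0)) := tendsto_id.const_mul R
      rw [mul_zero] at this
      exact this.mono_left nhdsWithin_le_nhds
    · filter_upwards [self_mem_nhdsWithin] with t ht using mul_pos hR ht
  have hx' := (hx.comp (Besicovitch.tendsto_filterAt volume x)).comp hlim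
  set V := volume.real (Metric.ball (0 : E n) 1) with hV
  have hVpos : 0 < V := by
    rw [hV, measureReal_def, ENNReal.toReal_pos_iff]
    exact ⟨Metric.measure_ball_pos _ _ one_pos, measure_ball_lt_top⟩
  have := tendsto_integral_smul_of_tendsto_average_norm_sub (μ := volume)
    (a := fun t : ℝ => Metric.closedBall x (R * t)) (g := fun t y => kernel G χ t (x - y))
    (M * R ^ n * V) hx' ?_ ?_ ?_ ?_
  · refine this.congr fun t => ?_
    rw [convolution_def]
    congr 1; funext y
    simp [mul_comm]
  · filter_upwards with t using hf.integrableOn_isCompact (isCompact_closedBall _ _)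
  · refine (tendsto_const_nhds (x := (1 : ℝ))).congr' ?_
    filter_upwards [self_mem_nhdsWithin] with t ht
    rw [integral_sub_left_eq_self (kernel G χ t) volume x, integral_kernel G χ ht, hint]
  · filter_upwards [self_mem_nhdsWithin] with t ht
    intro y hy
    have := tsupport_kernel_subset hR hG hχ1 ht (subset_tsupport _ hy)
    rw [mem_closedBall_zero_iff] at this
    rwa [Metric.mem_closedBall, dist_comm, dist_eq_norm]
  · filter_upwards [self_mem_nhdsWithin] with t ht y
    have ht' : 0 < t := ht
    have h1 : volume.real (Metric.closedBall x (R * t)) = (R * t) ^ n * V := by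
      have := Measure.addHaar_real_closedBall (volume : Measure (E n)) x (r := R * t)
        (by positivity)
      rwa [finrank_euclideanSpace_fin] at this
    have h2 := hM (t⁻¹ • (x - y))
    rw [Real.norm_eq_abs] at h2
    rw [kernel_eq_kernel_one, abs_mul, abs_of_pos (a := (t ^ n)⁻¹) (by positivity), h1]
    have h3 : M * R ^ n * V / ((R * t) ^ n * V) = (t ^ n)⁻¹ * M := by
      rw [mul_pow]; field_simp
    rw [h3]
    exact mul_le_mul_of_nonneg_left h2 (by positivity)

theorem hasDerivAt_mollification {n : ℕ} {A G : Matrix (Fin n) (Fin n) ℝ} (hGs : G.IsSymm)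
    (hAG : A * G = 1) {R : ℝ} (hR : 0 < R)
    (hG : ∀ z : E n, ‖z‖ ^ 2 ≤ R ^ 2 * quadratic G z) {χ : ℝ → ℝ} (hχ : ContDiff ℝ ∞ χ)
    (hχ1 : ∀ s, 1 ≤ s → χ s = 0) {f : E n → ℝ} (hf : LocallyIntegrable f) {t : ℝ} (ht : 0 < t)
    (x : E n) :
    HasDerivAt (fun s => (f ⋆[ContinuousLinearMap.mul ℝ ℝ] kernel G χ s) x)
      (t * (t ^ n)⁻¹ * ∫ y, f y * ellipticOp A (potential G χ t) (x - y)) t := by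
  let s : Set ℝ := Ioo 0 (t + 1)
  have hts : t ∈ s := ⟨ht, by linarith⟩
  have hs0 : ∀ r ∈ s, r ≠ 0 := fun r hr => hr.1.ne'
  have hzero : ∀ (p : ℝ) (z : E n), p ∈ s → z ∉ Metric.closedBall 0 (R * (t + 1)) →
      kernel G χ p z = 0 := by
    intro p z hp hz
    by_contra h
    have := tsupport_kernel_subset hR hG hχ1 hp.1 (subset_tsupport _ h)
    exact hz (Metric.closedBall_subset_closedBall (by have := hp.2.le; gcongr) this)
  have hsm := contDiffOn_uncurry_kernel G hχ hs0
  have hopen : IsOpen (s ×ˢ (univ : Set (E n))) := isOpen_Ioo.prod isOpen_univ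
  have h := hasFDerivAt_convolution_right_with_param (ContinuousLinearMap.mul ℝ ℝ)
    (g := fun p z => kernel G χ p z) (s := s)
    isOpen_Ioo (isCompact_closedBall (0 : E n) (R * (t + 1))) hzero hf
    (hsm.of_le (by simp)) (t, x) hts
  have hline : HasDerivAt (fun r : ℝ => (r, x)) ((1 : ℝ), (0 : E n)) t :=
    (hasDerivAt_id t).prodMk (hasDerivAt_const t x)
  refine (h.comp_hasDerivAt t hline).congr_deriv ?_
  have hfd : ∀ z : E n, fderiv ℝ (fun p : ℝ × E n => kernel G χ p.1 p.2) (t, z) (1, 0) =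
      t * (t ^ n)⁻¹ * ellipticOp A (potential G χ t) z := by
    intro z
    have hd : DifferentiableAt ℝ (fun p : ℝ × E n => kernel G χ p.1 p.2) (t, z) :=
      (hsm.contDiffAt (hopen.mem_nhds ⟨hts, mem_univ _⟩)).differentiableAt (by simp)
    have hl : HasDerivAt (fun r : ℝ => (r, z)) ((1 : ℝ), (0 : E n)) t :=
      (hasDerivAt_id t).prodMk (hasDerivAt_const t z)
    have hd' : HasDerivAt (fun s => kernel G χ s z) _ t :=
      HasFDerivAt.comp_hasDerivAt (f := fun r : ℝ => (r, z)) t hd.hasFDerivAt hl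
    exact hd'.unique (hasDerivAt_kernel hGs hAG hχ ht z)
  have hcs : HasCompactSupport fun z : E n =>
      fderiv ℝ (fun p : ℝ × E n => kernel G χ p.1 p.2) (t, z) := by
    refine HasCompactSupport.intro (isCompact_closedBall (0 : E n) (R * (t + 1))) fun z hz => ?_
    have : (fun p : ℝ × E n => kernel G χ p.1 p.2) =ᶠ[𝓝 (t, z)] fun _ => 0 := by
      filter_upwards [(isOpen_Ioo.prod Metric.isClosed_closedBall.isOpen_compl).mem_nhds
        (show (t, z) ∈ s ×ˢ (Metric.closedBall 0 (R * (t + 1)))ᶜ from ⟨hts, hz⟩)] with p hp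
      exact hzero _ _ hp.1 hp.2
    rw [this.fderiv_eq]
    simp
  have hcont : Continuous fun z : E n =>
      fderiv ℝ (fun p : ℝ × E n => kernel G χ p.1 p.2) (t, z) :=
    (hsm.continuousOn_fderiv_of_isOpen hopen (by simp)).comp_continuous
      (Continuous.prodMk_right t) fun z => ⟨hts, mem_univ _⟩
  have hconv := convolution_precompR_apply (ContinuousLinearMap.mul ℝ ℝ) hf hcs hcont x
    ((1 : ℝ), (0 : E n))
  refine hconv.trans ?_
  simp only [hfd]
  rw [convolution_def, ← integral_const_mul]
  congr 1
  funext y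
  simp only [ContinuousLinearMap.mul_apply']
  ring

/-! ### The essential limit superior -/

/-- An essential bound near `x` is also an essential bound near all points close to `x`. -/
theorem eventually_nhds_ae_of_essLimsup_lt {n : ℕ} {f : E n → ℝ} {x : E n} {c : EReal}
    (h : essLimsup f x < c) : ∀ᶠ y in 𝓝 x, ∀ᶠ z in 𝓝 y ⊓ ae volume, (f z : EReal) < c := by
  have h1 : ∀ᶠ y in 𝓝 x ⊓ ae volume, (f y : EReal) < c := eventually_lt_of_limsup_lt h
  obtain ⟨s, hs, t, ht, hst⟩ := mem_inf_iff_superset.1 h1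
  filter_upwards [eventually_mem_nhds_iff.2 hs] with y hy
  exact mem_inf_iff_superset.2 ⟨s, hy, t, ht, hst⟩

theorem upperSemicontinuous_essLimsup {n : ℕ} (f : E n → ℝ) :
    UpperSemicontinuous (essLimsup f) := by
  intro x c hc
  obtain ⟨c', hxc', hc'c⟩ := exists_between hc
  filter_upwards [eventually_nhds_ae_of_essLimsup_lt hxc'] with y hy
  exact (limsup_le_of_le (h := hy.mono fun z hz => hz.le)).trans_lt hc'c

theorem essLimsup_le_of_ae_le {n : ℕ} {f g : E n → ℝ} {x : E n} (hg : ContinuousAt g x)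
    {U : Set (E n)} (hU : U ∈ 𝓝 x) (h : ∀ᵐ y, y ∈ U → f y ≤ g y) :
    essLimsup f x ≤ (g x : EReal) := by
  refine le_of_forall_gt_imp_ge_of_dense fun c hc => ?_
  have hg' : ContinuousAt (fun y => (g y : EReal)) x :=
    continuous_coe_real_ereal.continuousAt.comp hg
  refine limsup_le_of_le (h := ?_)
  have h1 : ∀ᶠ y in 𝓝 x ⊓ ae volume, (g y : EReal) < c :=
    (hg'.eventually (gt_mem_nhds hc)).filter_mono inf_le_left
  have h2 : ∀ᶠ y in 𝓝 x ⊓ ae volume, y ∈ U := mem_inf_of_left hU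
  have h3 : ∀ᶠ y in 𝓝 x ⊓ ae volume, y ∈ U → f y ≤ g y := mem_inf_of_right h
  filter_upwards [h1, h2, h3] with y hy1 hy2 hy3
  exact (EReal.coe_le_coe_iff.2 (hy3 hy2)).trans hy1.le

/-! ### Smooth approximation of plurisubharmonic functions -/

/-- Near each point of `X`, the canonical representative of a plurisubharmonic distribution lies below
smooth functions `F t` with `½ D²(F t) ∈ P⁺`, and the upper relaxed limit of `F t` as `t → 0` lies
below the canonical representative. -/
theorem exists_smooth_approximation {n : ℕ} {P : ProperCone ℝ (Matrix (Fin n) (Fin n) ℝ)}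
    (hP : IsEllipticCone P) {X : TopologicalSpace.Opens (E n)} {T : 𝓓'(X, ℝ)} {f : E n → ℝ}
    (hT : IsPSHDistribution P T) (hTf : IsRepresentedBy T f) {x₀ : E n} (hx₀ : x₀ ∈ X) :
    ∃ r > 0, Metric.ball x₀ r ⊆ X ∧ ∃ t₀ > 0, ∃ F : ℝ → E n → ℝ,
      (∀ t ∈ Ioo 0 t₀, ContDiff ℝ ∞ (F t)) ∧
      (∀ t ∈ Ioo 0 t₀, ∀ x ∈ Metric.ball x₀ r, (1 / 2 : ℝ) • hessian (F t) x ∈ P) ∧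
      (∀ t ∈ Ioo 0 t₀, ∀ x ∈ Metric.ball x₀ r, essLimsup f x ≤ (F t x : EReal)) ∧
      ∀ x ∈ Metric.ball x₀ r, ∀ c : ℝ, essLimsup f x < (c : EReal) →
        ∀ᶠ p : ℝ × E n in 𝓝 (0, x), 0 < p.1 → F p.1 p.2 ≤ c := by
  obtain ⟨A, hA, hApos⟩ := exists_posDef_mem_polar hP
  set G := A⁻¹ with hGdef
  have hGpos : G.PosDef := hApos.inv
  have hGs : G.IsSymm := by simpa using hGpos.isHermitian
  have hAG : A * G = 1 := Matrix.mul_nonsing_inv A (A.isUnit_iff_isUnit_det.1 hApos.isUnit)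
  obtain ⟨R, hR, hRG⟩ := exists_norm_sq_le_quadratic hGpos
  obtain ⟨χ, hχ, hχ1, hχ0, hχd, hint⟩ := exists_profile hGpos
  obtain ⟨ρ, hρ, hρX⟩ := Metric.nhds_basis_closedBall.mem_iff.1 (X.isOpen.mem_nhds hx₀)
  -- on the ball of radius `r`, mollifications at scales below `r / R` only see the values of `f`
  -- on the closed ball of radius `ρ`
  set r := ρ / 2 with hr
  have hr0 : 0 < r := by positivity
  set f' : E n → ℝ := (Metric.closedBall x₀ ρ).indicator f with hf'
  have hf'int : Integrable f' := by
    refine IntegrableOn.integrable_indicator ?_ Metric.isClosed_closedBall.measurableSet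
    exact hTf.1.integrableOn_compact_subset hρX (isCompact_closedBall _ _)
  have hloc : LocallyIntegrable f' := hf'int.locallyIntegrable
  have hmem : ∀ {t : ℝ}, t < r / R → ∀ {x y : E n}, x ∈ Metric.ball x₀ r →
      x - y ∈ Metric.closedBall (0 : E n) (R * t) → y ∈ Metric.closedBall x₀ ρ := by
    intro t ht x y hx hy
    rw [lt_div_iff₀ hR] at ht
    rw [Metric.mem_ball, dist_eq_norm] at hx
    rw [mem_closedBall_zero_iff] at hy
    rw [Metric.mem_closedBall, dist_eq_norm]
    calc ‖y - x₀‖ = ‖(x - x₀) - (x - y)‖ := by congr 1; abel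
      _ ≤ ‖x - x₀‖ + ‖x - y‖ := norm_sub_le _ _
      _ ≤ ρ := by rw [hr] at *; linarith
  have hpos : ∀ B ∈ polar P, ∀ (t : ℝ) (_ : t < r / R) (ψ : E n → ℝ) (_ : ContDiff ℝ ∞ ψ)
      (_ : tsupport ψ ⊆ Metric.closedBall 0 (R * t)) (_ : ∀ z, 0 ≤ ψ z),
      ∀ x ∈ Metric.ball x₀ r, 0 ≤ ∫ y, f' y * ellipticOp B ψ (x - y) := by
    intro B hB t ht ψ hψ hψs hψ0 x hx
    have hcs : HasCompactSupport ψ :=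
      (isCompact_closedBall _ _).of_isClosed_subset (isClosed_tsupport _) hψs
    have h := integral_mul_ellipticOp_nonneg hT hTf hB hψ hcs hψ0 (x := x)
      fun y hy => hρX (hmem ht hx (hψs hy))
    convert h using 3 with y
    by_cases hy : x - y ∈ tsupport ψ
    · rw [hf', indicator_of_mem (hmem ht hx (hψs hy))]
    · rw [ellipticOp_eq_zero_of_notMem_tsupport B hy, mul_zero, mul_zero]
  have hcs : ∀ {t : ℝ}, 0 < t → HasCompactSupport (kernel (n := n) G χ t) := fun ht =>
    (isCompact_closedBall _ _).of_isClosed_subset (isClosed_tsupport _)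
      (tsupport_kernel_subset hR hRG hχ1 ht)
  have hsm : ∀ t ∈ Ioo 0 (r / R),
      ContDiff ℝ ∞ (f' ⋆[ContinuousLinearMap.mul ℝ ℝ] kernel G χ t) := fun t ht =>
    (hcs ht.1).contDiff_convolution_right _ hloc (contDiff_kernel G hχ t)
  have hmono : ∀ x ∈ Metric.ball x₀ r, MonotoneOn
      (fun t => (f' ⋆[ContinuousLinearMap.mul ℝ ℝ] kernel G χ t) x) (Ioo 0 (r / R)) := by
    intro x hx
    have hd : ∀ t ∈ Ioo 0 (r / R), HasDerivAt
        (fun s => (f' ⋆[ContinuousLinearMap.mul ℝ ℝ] kernel G χ s) x)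
        (t * (t ^ n)⁻¹ * ∫ y, f' y * ellipticOp A (potential G χ t) (x - y)) t := fun t ht =>
      hasDerivAt_mollification hGs hAG hR hRG hχ hχ1 hloc ht.1 x
    refine monotoneOn_of_deriv_nonneg (convex_Ioo _ _)
      (fun t ht => (hd t ht).continuousAt.continuousWithinAt) ?_ ?_ <;>
      rw [interior_Ioo]
    · exact fun t ht => (hd t ht).differentiableAt.differentiableWithinAt
    · intro t ht
      have ht0 := ht.1
      rw [(hd t ht).deriv]
      exact mul_nonneg (by positivity) (hpos A hA t ht.2 _ (contDiff_potential G hχ t)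
        (tsupport_potential_subset hR hRG hχ1 ht.1) (fun z => hχ0 _) x hx)
  refine ⟨r, hr0, (Metric.ball_subset_closedBall.trans
    (Metric.closedBall_subset_closedBall (by linarith))).trans hρX, r / R, by positivity,
    fun t => f' ⋆[ContinuousLinearMap.mul ℝ ℝ] kernel G χ t, hsm, ?_, ?_, ?_⟩
  · intro t ht x hx
    have h2 : ContDiff ℝ 2 (f' ⋆[ContinuousLinearMap.mul ℝ ℝ] kernel G χ t) :=
      (hsm t ht).of_le (WithTop.coe_le_coe.2 le_top)
    refine mem_of_forall_polar hP ((hessian_isSymm h2 x).smul _) fun B hB => ?_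
    rw [Matrix.mul_smul, Matrix.trace_smul, ← ellipticOp_eq_trace B h2,
      ellipticOp_convolution B hloc (contDiff_kernel G hχ t) (hcs ht.1)]
    exact mul_nonneg (by norm_num) (hpos B hB t ht.2 _ (contDiff_kernel G hχ t)
      (tsupport_kernel_subset hR hRG hχ1 ht.1) (kernel_nonneg G hχd ht.1) x hx)
  · intro t ht x hx
    refine essLimsup_le_of_ae_le (hsm t ht).continuous.continuousAt
      (Metric.isOpen_ball.mem_nhds hx) ?_
    filter_upwards [ae_tendsto_mollification hR hRG hχ hχ1 hint hloc] with y hy hyb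
    have hfy : f' y = f y := indicator_of_mem
      (Metric.ball_subset_closedBall (Metric.ball_subset_ball (by linarith) hyb)) f
    rw [← hfy]
    refine le_of_tendsto hy ?_
    filter_upwards [Ioo_mem_nhdsGT ht.1] with s hs
    exact hmono y hyb ⟨hs.1, hs.2.trans ht.2⟩ ht hs.2.le
  · intro x hx c hc
    have h1 : ∀ᶠ y in 𝓝 x ⊓ ae volume, (f y : EReal) < c := eventually_lt_of_limsup_lt hc
    obtain ⟨s, hs, w, hw, hsw⟩ := mem_inf_iff_superset.1 h1
    obtain ⟨δ, hδ, hδs⟩ := Metric.nhds_basis_ball.mem_iff.1 hs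
    have e1 : ∀ᶠ p : ℝ × E n in 𝓝 (0, x), p.1 < r / R ∧ R * p.1 < δ / 2 := by
      have hc1 : Tendsto (fun p : ℝ × E n => p.1) (𝓝 (0, x)) (𝓝 0) := continuous_fst.tendsto _
      have hc2 : Tendsto (fun p : ℝ × E n => R * p.1) (𝓝 (0, x)) (𝓝 0) := by
        have := hc1.const_mul R
        rwa [mul_zero] at this
      exact (hc1.eventually (gt_mem_nhds (by positivity))).and
        (hc2.eventually (gt_mem_nhds (by positivity)))
    have e2 : ∀ᶠ p : ℝ × E n in 𝓝 (0, x), p.2 ∈ Metric.ball x (δ / 2) ∩ Metric.ball x₀ r :=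
      (continuous_snd.tendsto (0, x)).eventually
        ((Metric.isOpen_ball.inter Metric.isOpen_ball).mem_nhds
          ⟨Metric.mem_ball_self (by positivity), hx⟩)
    filter_upwards [e1, e2] with p hp1 hp2 hp0
    refine mollification_le_of_ae_le hR hRG hχ hχ1 hχd hint hloc hp0 ?_
    filter_upwards [hw] with y hy hyb
    have hy1 : y ∈ Metric.closedBall x₀ ρ := by
      refine hmem hp1.1 hp2.2 ?_
      rw [mem_closedBall_zero_iff, ← dist_eq_norm, dist_comm]
      exact hyb
    have hy2 : y ∈ Metric.ball x δ := by
      have h3 := hp2.1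
      rw [Metric.mem_ball] at h3 ⊢
      rw [Metric.mem_closedBall] at hyb
      have := dist_triangle y p.2 x
      linarith [hp1.2]
    rw [hf', indicator_of_mem hy1]
    exact (EReal.coe_lt_coe_iff.1 (hsw ⟨hδs hy2, hy⟩)).le

/-! ### The subaffine theorem -/

theorem exists_real_gt_of_add_lt {u v : EReal} {b : ℝ} (hu : u ≠ ⊤) (hv : v ≠ ⊤)
    (h : u + v < (b : EReal)) :
    ∃ c d : ℝ, u < (c : EReal) ∧ v < (d : EReal) ∧ c + d < b := by
  induction u with
  | top => exact absurd rfl hu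
  | bot =>
    obtain ⟨d, hd, -⟩ := EReal.lt_iff_exists_real_btwn.1 (lt_top_iff_ne_top.2 hv)
    exact ⟨b - d - 1, d, EReal.bot_lt_coe _, hd, by linarith⟩
  | coe u =>
    induction v with
    | top => exact absurd rfl hv
    | bot =>
      exact ⟨u + 1, b - u - 2, EReal.coe_lt_coe_iff.2 (by linarith), EReal.bot_lt_coe _,
        by linarith⟩
    | coe v =>
      rw [← EReal.coe_add, EReal.coe_lt_coe_iff] at h
      exact ⟨u + (b - u - v) / 3, v + (b - u - v) / 3, EReal.coe_lt_coe_iff.2 (by linarith),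
        EReal.coe_lt_coe_iff.2 (by linarith), by linarith⟩

end Subaffine

theorem theorem7p8 (n : ℕ) (P : ProperCone ℝ (Matrix (Fin n) (Fin n) ℝ))
    (hP : Subaffine.IsEllipticCone P)
    (X : TopologicalSpace.Opens (Subaffine.E n))
    (u v : Subaffine.E n → EReal)
    (hu : Subaffine.IsPSH P X u) (hv : Subaffine.IsDualType P X v) :
    Subaffine.IsSA X (fun x => u x + v x) := by
  obtain ⟨T, f, hT, hTf, huf⟩ := hu
  have hu_top : ∀ x ∈ X, u x ≠ ⊤ := by
    intro x hx
    obtain ⟨r, hr, -, t₀, ht₀, F, -, -, hF, -⟩ :=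
      Subaffine.exists_smooth_approximation hP hT hTf hx
    rw [huf x hx]
    exact ((hF (t₀ / 2) ⟨by positivity, by linarith⟩ x (Metric.mem_ball_self hr)).trans_lt
      (EReal.coe_lt_top _)).ne
  have hu_usc : UpperSemicontinuousOn u X := by
    intro x hx c hc
    rw [huf x hx] at hc
    filter_upwards [nhdsWithin_le_nhds (Subaffine.upperSemicontinuous_essLimsup f x c hc),
      self_mem_nhdsWithin] with y hy hyX
    rwa [huf y hyX]
  have husc : Subaffine.IsUSC (X : Set (Subaffine.E n)) (fun x => u x + v x) :=
    ⟨Subaffine.upperSemicontinuousOn_add hu_usc hv.1.1 hu_top hv.1.2,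
      fun x hx => EReal.add_ne_top (hu_top x hx) (hv.1.2 x hx)⟩
  refine ⟨husc, fun x₀ hx₀ => ?_⟩
  obtain ⟨r, hr, hrX, t₀, ht₀, F, hF1, hF2, hF3, hF4⟩ :=
    Subaffine.exists_smooth_approximation hP hT hTf hx₀
  refine ⟨Metric.ball x₀ r, Metric.isOpen_ball, Metric.mem_ball_self hr, hrX,
    ⟨husc.1.mono hrX, fun x hx => husc.2 x (hrX hx)⟩, fun K hKB hK a ha x hx => ?_⟩
  by_contra! hlt
  obtain ⟨b, hab, hb⟩ := EReal.lt_iff_exists_real_btwn.1 hlt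
  rw [EReal.coe_lt_coe_iff] at hab
  set ε := b - a x with hε
  have hε0 : 0 < ε := by linarith
  have hacont : Continuous a := a.continuous_of_finiteDimensional
  have hfr : frontier K ⊆ K := hK.isClosed.frontier_subset
  have hev : ∀ᶠ t in 𝓝 (0 : ℝ), ∀ y ∈ frontier K, 0 < t →
      (F t y : EReal) + v y ≤ ((a y + ε : ℝ) : EReal) := by
    refine (hK.of_isClosed_subset isClosed_frontier hfr).eventually_forall_of_forall_eventually
      fun y hy => ?_
    have hyB := hKB (hfr hy)
    have hyX := hrX hyB
    have h1 : u y + v y < ((a y + ε : ℝ) : EReal) :=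
      (ha y hy).trans_lt (EReal.coe_lt_coe_iff.2 (by linarith))
    obtain ⟨c, d, hc, hd, hcd⟩ :=
      Subaffine.exists_real_gt_of_add_lt (hu_top y hyX) (hv.1.2 y hyX) h1
    rw [huf y hyX] at hc
    have e2 : ∀ᶠ z in 𝓝 y, v z < d := by
      have := hv.1.1 y hyX d hd
      rwa [X.isOpen.nhdsWithin_eq hyX] at this
    have e3 : ∀ᶠ z in 𝓝 y, c + d < a z + ε :=
      (hacont.add continuous_const).continuousAt.eventually (lt_mem_nhds hcd)
    have hsnd : Filter.Tendsto (fun p : ℝ × Subaffine.E n => p.2) (𝓝 (0, y)) (𝓝 y) :=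
      continuous_snd.tendsto (0, y)
    filter_upwards [hF4 y hyB c hc, hsnd.eventually e2, hsnd.eventually e3] with p h1 h2 h3 hp
    calc (F p.1 p.2 : EReal) + v p.2 ≤ (c : EReal) + (d : EReal) :=
          add_le_add (EReal.coe_le_coe_iff.2 (h1 hp)) h2.le
      _ ≤ _ := by rw [← EReal.coe_add]; exact EReal.coe_le_coe_iff.2 h3.le
  -- at such a scale the smooth comparison applies, and `u ≤ F t` on `K`
  obtain ⟨t, ht, htt⟩ := ((hev.filter_mono nhdsWithin_le_nhds).and
    (Ioo_mem_nhdsGT ht₀)).exists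
  have hcomp := Subaffine.comparison_of_paraboloid_below hv (hKB.trans hrX) hK
    (hF1 t htt).continuous (fun y hy => ⟨_, hF2 t htt y (hKB hy),
      Subaffine.exists_affine_paraboloid_le ((hF1 t htt).of_le (WithTop.coe_le_coe.2 le_top)) y⟩)
    (a + AffineMap.const ℝ (Subaffine.E n) ε) (fun y hy => ht y hy htt.1) x hx
  have h5 : u x + v x ≤ (b : EReal) := by
    calc u x + v x ≤ (F t x : EReal) + v x := by
          rw [huf x (hrX (hKB hx))]
          exact add_le_add (hF3 t htt x (hKB hx)) le_rfl
      _ ≤ _ := hcomp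
      _ = b := by simp [hε, -EReal.coe_add]
  exact absurd hb (not_lt.2 h5)
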